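/- For a set $\Omega\subset\mathbb{R}$ and a function $f$ on $\Omega$, let \[\mathcal{E}_{\Omega}f(x',x^*):=\int_{\Omega} f(\xi)\,e^{2\pi i(x'\xi+x^*\xi^2)}\,d\xi,\qquad (x',x^*)\in\mathbb{R}\times\mathbb{R}=\mathbb{R}^2,\] be the extension operator of the parabola. For every $D>0$ there is a constant $C=C(D)$ such that for all nonempty intervals $J_1,J_2\subset[-1,1]$ with \[d(J_1,J_2):=\inf\{|\xi_1-\xi_2| : \xi_1\in J_1,\ \xi_2\in J_2\}\geq D\] and all $f\in L^2(J_1\cup J_2;\mathbb{C})$, \[\big\|\,|\mathcal{E}_{J_1}f\cdot\mathcal{E}_{J_2}f|^{1/2}\,\big\|_{L^4(\mathbb{R}^2)}\leq C\,\big(\|f\|_{L^2(J_1)}\,\|f\|_{L^2(J_2)}\big)^{1/2}.\] In particular, the estimate holds for every pair of intervals in $[-1,1]$ at positive distance, with a constant independent of $f$. -/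

import Mathlib

open MeasureTheory
open scoped NNReal ENNReal

/-- The extension operator of the parabola over a set `Ω ⊆ ℝ`: for `x = (x', x*) ∈ ℝ × ℝ`,
`parabolaExt Ω f x = ∫_Ω f(ξ) e^{2πi (x' ξ + x* ξ²)} dξ`. -/
noncomputable def parabolaExt (Ω : Set ℝ) (f : ℝ → ℂ) (x : ℝ × ℝ) : ℂ :=
  ∫ ξ in Ω, f ξ * Complex.exp (2 * Real.pi * Complex.I * ((x.1 * ξ + x.2 * ξ ^ 2 : ℝ) : ℂ))

/-- The distance `inf {|x₁ - x₂| : x₁ ∈ A, x₂ ∈ B}` between two nonempty sets of reals. -/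
noncomputable def setDist (A B : Set ℝ) : ℝ :=
  sInf (Set.image2 dist A B)

/-! The product of the two extensions is the Fourier transform of the push-forward of `f ⊗ f` on `J₁
× J₂` under `(ξ, η) ↦ (ξ + η, ξ² + η²)`. Separation makes this map injective there, with Jacobian
`2|ξ - η| ≥ 2D`, so Lebesgue measure on `J₁ × J₂` pushes forward to a measure of density at most
`1/(2D)` (`map_parabolaSum_le`). An `L²` bound of Plancherel type
(`lintegral_sq_integral_planeChar_le`) then gives the estimate.

That bound is proved directly: a Gaussian weight is inserted, the square is expanded, and the
resulting approximate-identity kernel is handled by a Schur test uniformly in its width. Fatou's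
lemma removes the weight. -/

/-- The character `x ↦ e^{2πi x·y}` of the plane. -/
noncomputable def planeChar (x y : ℝ × ℝ) : ℂ :=
  Complex.exp (2 * Real.pi * Complex.I * ((x.1 * y.1 + x.2 * y.2 : ℝ) : ℂ))

/-- The Gaussian `e^{-π s² |x|²}` on the plane. -/
noncomputable def gaussWeight (s : ℝ) (x : ℝ × ℝ) : ℝ :=
  Real.exp (-(Real.pi * s ^ 2) * x.1 ^ 2) * Real.exp (-(Real.pi * s ^ 2) * x.2 ^ 2)

/-- The Fourier transform `s⁻² e^{-π |y|² / s²}` of `gaussWeight s`. -/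
noncomputable def gaussKernel (s : ℝ) (y : ℝ × ℝ) : ℝ :=
  (s⁻¹ * Real.exp (-(Real.pi / s ^ 2) * y.1 ^ 2)) * (s⁻¹ * Real.exp (-(Real.pi / s ^ 2) * y.2 ^ 2))

lemma norm_planeChar (x y : ℝ × ℝ) : ‖planeChar x y‖ = 1 := by
  unfold planeChar
  rw [show (2 * Real.pi * Complex.I * ((x.1 * y.1 + x.2 * y.2 : ℝ) : ℂ)) =
    ((2 * Real.pi * (x.1 * y.1 + x.2 * y.2) : ℝ) : ℂ) * Complex.I by push_cast; ring]
  exact Complex.norm_exp_ofReal_mul_I _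

lemma planeChar_mul_conj (x y z : ℝ × ℝ) :
    planeChar x y * (starRingEnd ℂ) (planeChar x z) = planeChar x (y - z) := by
  unfold planeChar
  rw [← Complex.exp_conj, ← Complex.exp_add]
  congr 1
  simp only [map_mul, Complex.conj_I, Complex.conj_ofReal, map_ofNat, Prod.fst_sub, Prod.snd_sub]
  push_cast
  ring

lemma continuous_planeChar : Continuous fun z : (ℝ × ℝ) × (ℝ × ℝ) => planeChar z.1 z.2 := by
  unfold planeChar
  fun_prop

lemma continuous_gaussWeight (s : ℝ) : Continuous (gaussWeight s) := by
  unfold gaussWeight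
  fun_prop

lemma continuous_gaussKernel (s : ℝ) : Continuous (gaussKernel s) := by
  unfold gaussKernel
  fun_prop

lemma gaussWeight_nonneg (s : ℝ) (x : ℝ × ℝ) : 0 ≤ gaussWeight s x := by
  unfold gaussWeight
  positivity

lemma gaussKernel_nonneg {s : ℝ} (hs : 0 < s) (y : ℝ × ℝ) : 0 ≤ gaussKernel s y := by
  unfold gaussKernel
  positivity

lemma gaussKernel_neg (s : ℝ) (y : ℝ × ℝ) : gaussKernel s (-y) = gaussKernel s y := by
  simp [gaussKernel]

lemma integrable_gaussWeight {s : ℝ} (hs : 0 < s) : Integrable (gaussWeight s) := by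
  have h : Integrable fun x : ℝ => Real.exp (-(Real.pi * s ^ 2) * x ^ 2) :=
    integrable_exp_neg_mul_sq (by positivity)
  exact h.mul_prod h

lemma integral_char_mul_gaussian {s : ℝ} (hs : 0 < s) (t : ℝ) :
    ∫ x : ℝ, Complex.exp (2 * Real.pi * Complex.I * ((x * t : ℝ) : ℂ)) *
        (Real.exp (-(Real.pi * s ^ 2) * x ^ 2) : ℂ) =
      ((s⁻¹ * Real.exp (-(Real.pi / s ^ 2) * t ^ 2) : ℝ) : ℂ) := by
  have hb : 0 < (((Real.pi * s ^ 2 : ℝ) : ℂ)).re := by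
    rw [Complex.ofReal_re]; positivity
  have hs' : (s : ℂ) ≠ 0 := by exact_mod_cast hs.ne'
  have hpi : (Real.pi : ℂ) ≠ 0 := by exact_mod_cast Real.pi_ne_zero
  have key := fourierIntegral_gaussian hb (2 * Real.pi * t : ℂ)
  have e1 : ((Real.pi : ℂ) / ((Real.pi * s ^ 2 : ℝ) : ℂ)) ^ (1 / 2 : ℂ) = ((s⁻¹ : ℝ) : ℂ) := by
    have : (Real.pi : ℂ) / ((Real.pi * s ^ 2 : ℝ) : ℂ) = (((s⁻¹) ^ 2 : ℝ) : ℂ) := by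
      push_cast; field_simp
    rw [this, show (1 / 2 : ℂ) = ((1 / 2 : ℝ) : ℂ) by push_cast; rfl,
      ← Complex.ofReal_cpow (by positivity), ← Real.sqrt_eq_rpow,
      Real.sqrt_sq (by positivity)]
  rw [e1] at key
  rw [Complex.ofReal_mul, Complex.ofReal_exp]
  convert key using 3
  · rw [Complex.ofReal_exp]
    congr 2 <;> push_cast <;> ring
  · push_cast; field_simp; ring

lemma integral_planeChar_mul_gaussWeight {s : ℝ} (hs : 0 < s) (y : ℝ × ℝ) :
    ∫ x : ℝ × ℝ, planeChar x y * (gaussWeight s x : ℂ) = (gaussKernel s y : ℂ) := by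
  rw [gaussKernel, Complex.ofReal_mul, ← integral_char_mul_gaussian hs,
    ← integral_char_mul_gaussian hs, ← integral_prod_mul]
  refine integral_congr_ae (.of_forall fun x => ?_)
  simp only [planeChar, gaussWeight]
  rw [Complex.ofReal_add, mul_add, Complex.exp_add, Complex.ofReal_mul (Real.exp _)]
  ring

lemma lintegral_gaussKernel {s : ℝ} (hs : 0 < s) :
    ∫⁻ y : ℝ × ℝ, ENNReal.ofReal (gaussKernel s y) = 1 := by
  have h : Integrable fun x : ℝ => s⁻¹ * Real.exp (-(Real.pi / s ^ 2) * x ^ 2) :=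
    (integrable_exp_neg_mul_sq (by positivity)).const_mul _
  have hi : Integrable (gaussKernel s) := h.mul_prod h
  have h1 : ∫ x : ℝ, s⁻¹ * Real.exp (-(Real.pi / s ^ 2) * x ^ 2) = 1 := by
    rw [integral_const_mul, integral_gaussian, div_div_cancel₀ Real.pi_ne_zero,
      Real.sqrt_sq hs.le, inv_mul_cancel₀ hs.ne']
  rw [← ofReal_integral_eq_lintegral_ofReal hi (.of_forall (gaussKernel_nonneg hs))]
  have h2 : ∫ y, gaussKernel s y = 1 := by
    have := integral_prod_mul (μ := (volume : Measure ℝ)) (ν := (volume : Measure ℝ))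
      (fun x : ℝ => s⁻¹ * Real.exp (-(Real.pi / s ^ 2) * x ^ 2))
      (fun x : ℝ => s⁻¹ * Real.exp (-(Real.pi / s ^ 2) * x ^ 2))
    rw [h1, mul_one] at this
    exact this
  rw [h2, ENNReal.ofReal_one]

/-! ### Plancherel-type bound by Gaussian regularisation -/

section Bessel

variable {α : Type*} [MeasurableSpace α] {ρ : Measure α} {Φ : α → ℝ × ℝ} {h : α → ℂ}

lemma lintegral_gaussKernel_sub_le {K : ℝ≥0∞} (hΦ : Measurable Φ)
    (hK : ρ.map Φ ≤ K • volume) {s : ℝ} (hs : 0 < s) (y : ℝ × ℝ) :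
    ∫⁻ q, ENNReal.ofReal (gaussKernel s (y - Φ q)) ∂ρ ≤ K := by
  have hm : Measurable fun z => ENNReal.ofReal (gaussKernel s (y - z)) :=
    ((continuous_gaussKernel s).measurable.comp (measurable_const.sub measurable_id)).ennreal_ofReal
  calc ∫⁻ q, ENNReal.ofReal (gaussKernel s (y - Φ q)) ∂ρ
      = ∫⁻ z, ENNReal.ofReal (gaussKernel s (y - z)) ∂(ρ.map Φ) := (lintegral_map hm hΦ).symm
    _ ≤ ∫⁻ z, ENNReal.ofReal (gaussKernel s (y - z)) ∂(K • volume) := lintegral_mono' hK le_rfl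
    _ = K := by
      rw [lintegral_smul_measure,
        lintegral_sub_left_eq_self (fun z => ENNReal.ofReal (gaussKernel s z)) y,
        lintegral_gaussKernel hs, smul_eq_mul, mul_one]

lemma lintegral_prod_gaussKernel_le [SFinite ρ] {K : ℝ≥0∞} (hΦ : Measurable Φ)
    (hK : ρ.map Φ ≤ K • volume) (hh : AEStronglyMeasurable h ρ) {s : ℝ} (hs : 0 < s) :
    ∫⁻ z : α × α, ‖h z.1‖ₑ ^ 2 * ENNReal.ofReal (gaussKernel s (Φ z.1 - Φ z.2)) ∂(ρ.prod ρ) ≤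
      K * ∫⁻ p, ‖h p‖ₑ ^ 2 ∂ρ := by
  have hk : Measurable fun z : α × α => ENNReal.ofReal (gaussKernel s (Φ z.1 - Φ z.2)) :=
    ((continuous_gaussKernel s).measurable.comp (by fun_prop)).ennreal_ofReal
  have hh2 : AEMeasurable (fun p => ‖h p‖ₑ ^ 2) ρ := hh.enorm.pow_const 2
  rw [lintegral_prod _ (by exact hh2.comp_fst.mul hk.aemeasurable), mul_comm,
    ← lintegral_mul_const'' _ hh2]
  refine lintegral_mono fun p => ?_
  have hkp : Measurable fun q => ENNReal.ofReal (gaussKernel s (Φ p - Φ q)) :=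
    ((continuous_gaussKernel s).measurable.comp (by fun_prop)).ennreal_ofReal
  exact (lintegral_const_mul (‖h p‖ₑ ^ 2) hkp).trans_le
    (mul_le_mul_right (lintegral_gaussKernel_sub_le hΦ hK hs _) _)

/-- Schur test: `2ab ≤ a² + b²` splits the integrand into two terms, equal after swapping the
variables because the kernel is even. -/
lemma lintegral_schur_gaussKernel_le [SFinite ρ] {K : ℝ≥0∞} (hΦ : Measurable Φ)
    (hK : ρ.map Φ ≤ K • volume) (hh : AEStronglyMeasurable h ρ) {s : ℝ} (hs : 0 < s) :
    ∫⁻ z : α × α, ‖h z.1‖ₑ * ‖h z.2‖ₑ * ENNReal.ofReal (gaussKernel s (Φ z.1 - Φ z.2))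
      ∂(ρ.prod ρ) ≤ K * ∫⁻ p, ‖h p‖ₑ ^ 2 ∂ρ := by
  have hk : Measurable fun z : α × α => ENNReal.ofReal (gaussKernel s (Φ z.1 - Φ z.2)) :=
    ((continuous_gaussKernel s).measurable.comp (by fun_prop)).ennreal_ofReal
  have hh2 : AEMeasurable (fun p => ‖h p‖ₑ ^ 2) ρ := hh.enorm.pow_const 2
  set A := fun z : α × α => ‖h z.1‖ₑ ^ 2 * ENNReal.ofReal (gaussKernel s (Φ z.1 - Φ z.2)) with hA
  have hAm : AEMeasurable A (ρ.prod ρ) := hh2.comp_fst.mul hk.aemeasurable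
  have hle := lintegral_prod_gaussKernel_le hΦ hK hh hs
  have hswap : ∫⁻ z, A z.swap ∂(ρ.prod ρ) = ∫⁻ z, A z ∂(ρ.prod ρ) := lintegral_prod_swap A
  have two : ∀ a b : ℝ≥0∞, 2 * (a * b) ≤ a ^ 2 + b ^ 2 := fun a b => by
    rcases eq_or_ne a ⊤ with rfl | ha
    · simp
    rcases eq_or_ne b ⊤ with rfl | hb
    · simp
    lift a to ℝ≥0 using ha
    lift b to ℝ≥0 using hb
    norm_cast
    have := two_mul_le_add_sq a b
    rwa [mul_assoc] at this
  have hsum : 2 * ∫⁻ z : α × α, ‖h z.1‖ₑ * ‖h z.2‖ₑ *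
      ENNReal.ofReal (gaussKernel s (Φ z.1 - Φ z.2)) ∂(ρ.prod ρ) ≤
      2 * ∫⁻ z, A z ∂(ρ.prod ρ) := by
    rw [← lintegral_const_mul' _ _ (by simp), two_mul (∫⁻ z, A z ∂(ρ.prod ρ))]
    nth_rw 2 [← hswap]
    rw [← lintegral_add_left' hAm]
    refine lintegral_mono fun z => ?_
    have hsymm : gaussKernel s (Φ z.2 - Φ z.1) = gaussKernel s (Φ z.1 - Φ z.2) := by
      rw [← gaussKernel_neg, neg_sub]
    simp only [hA, Prod.fst_swap, Prod.snd_swap, hsymm]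
    rw [← add_mul, ← mul_assoc]
    gcongr
    exact two _ _
  exact ((ENNReal.mul_le_mul_iff_right (by simp) (by simp)).1 hsum).trans hle

/-- The square is expanded as a double integral; the Gaussian makes Fubini legitimate, and
integrating in `x` first turns the weight into its Fourier transform. -/
lemma integral_normSq_mul_gaussWeight [SFinite ρ] (hΦ : Measurable Φ) (hh : Integrable h ρ)
    {s : ℝ} (hs : 0 < s) :
    ∫ x, ((‖∫ p, h p * planeChar x (Φ p) ∂ρ‖ ^ 2 * gaussWeight s x : ℝ) : ℂ) =
      ∫ z : α × α, h z.1 * (starRingEnd ℂ) (h z.2) * (gaussKernel s (Φ z.1 - Φ z.2) : ℂ)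
        ∂(ρ.prod ρ) := by
  have hG : Integrable (fun w : (ℝ × ℝ) × (α × α) => (gaussWeight s w.1 : ℂ) *
      (h w.2.1 * (starRingEnd ℂ) (h w.2.2))) ((volume : Measure (ℝ × ℝ)).prod (ρ.prod ρ)) :=
    (integrable_gaussWeight hs).ofReal.mul_prod
      (hh.mul_prod (Complex.conjCLE.toContinuousLinearMap.integrable_comp hh))
  have hInt : Integrable (fun w : (ℝ × ℝ) × (α × α) =>
      planeChar w.1 (Φ w.2.1 - Φ w.2.2) * ((gaussWeight s w.1 : ℂ) *
      (h w.2.1 * (starRingEnd ℂ) (h w.2.2)))) ((volume : Measure (ℝ × ℝ)).prod (ρ.prod ρ)) := by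
    refine hG.bdd_mul (c := 1) ?_ (.of_forall fun w => (norm_planeChar _ _).le)
    exact (continuous_planeChar.measurable.comp
      (f := fun w : (ℝ × ℝ) × (α × α) => (w.1, Φ w.2.1 - Φ w.2.2))
      (by fun_prop)).aestronglyMeasurable
  calc _ = ∫ x, ∫ z : α × α, planeChar x (Φ z.1 - Φ z.2) * ((gaussWeight s x : ℂ) *
      (h z.1 * (starRingEnd ℂ) (h z.2))) ∂(ρ.prod ρ) := by
        congr 1 with x
        rw [Complex.ofReal_mul, Complex.ofReal_pow, ← Complex.mul_conj', ← integral_conj,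
          ← integral_prod_mul, ← integral_mul_const]
        congr 1 with z
        rw [← planeChar_mul_conj, map_mul]
        ring
    _ = ∫ z : α × α, (∫ x, planeChar x (Φ z.1 - Φ z.2) * ((gaussWeight s x : ℂ) *
      (h z.1 * (starRingEnd ℂ) (h z.2)))) ∂(ρ.prod ρ) := integral_integral_swap hInt
    _ = _ := by
        congr 1 with z
        simp_rw [← mul_assoc (planeChar _ _)]
        rw [integral_mul_const, integral_planeChar_mul_gaussWeight hs, mul_comm]

lemma continuous_integral_planeChar (hΦ : Measurable Φ) (hh : Integrable h ρ) :
    Continuous fun x => ∫ p, h p * planeChar x (Φ p) ∂ρ := by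
  refine continuous_of_dominated (bound := fun p => ‖h p‖) (fun x => ?_) (fun x => ?_) hh.norm ?_
  · exact hh.1.mul (continuous_planeChar.measurable.comp
      (f := fun p => (x, Φ p)) (by fun_prop)).aestronglyMeasurable
  · exact .of_forall fun p => by rw [norm_mul, norm_planeChar, mul_one]
  · exact .of_forall fun p => continuous_const.mul
      (continuous_planeChar.comp (f := fun x => (x, Φ p)) (by fun_prop))

lemma lintegral_sq_mul_gaussWeight_le [SFinite ρ] {K : ℝ≥0∞} (hΦ : Measurable Φ)
    (hK : ρ.map Φ ≤ K • volume) (hh : Integrable h ρ) {s : ℝ} (hs : 0 < s) :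
    ∫⁻ x, ‖∫ p, h p * planeChar x (Φ p) ∂ρ‖ₑ ^ 2 * ENNReal.ofReal (gaussWeight s x) ≤
      K * ∫⁻ p, ‖h p‖ₑ ^ 2 ∂ρ := by
  set F := fun x => ∫ p, h p * planeChar x (Φ p) ∂ρ with hF
  have hFb : ∀ x, ‖F x‖ ≤ ∫ p, ‖h p‖ ∂ρ := fun x =>
    (norm_integral_le_integral_norm _).trans_eq (by simp [norm_planeChar])
  have hFc : Continuous F := continuous_integral_planeChar hΦ hh
  have hI : Integrable fun x => ‖F x‖ ^ 2 * gaussWeight s x := by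
    refine (integrable_gaussWeight hs).bdd_mul (c := (∫ p, ‖h p‖ ∂ρ) ^ 2)
      (by fun_prop) (.of_forall fun x => ?_)
    rw [norm_pow, norm_norm]
    exact pow_le_pow_left₀ (norm_nonneg _) (hFb x) 2
  have hnn : ∀ x, 0 ≤ ‖F x‖ ^ 2 * gaussWeight s x := fun x =>
    mul_nonneg (by positivity) (gaussWeight_nonneg s x)
  calc ∫⁻ x, ‖F x‖ₑ ^ 2 * ENNReal.ofReal (gaussWeight s x)
      = ∫⁻ x, ENNReal.ofReal (‖F x‖ ^ 2 * gaussWeight s x) := by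
        congr 1 with x
        rw [ENNReal.ofReal_mul (by positivity), ENNReal.ofReal_pow (norm_nonneg _),
          ofReal_norm]
    _ = ENNReal.ofReal (∫ x, ‖F x‖ ^ 2 * gaussWeight s x) :=
        (ofReal_integral_eq_lintegral_ofReal hI (.of_forall hnn)).symm
    _ = ‖∫ x, ((‖F x‖ ^ 2 * gaussWeight s x : ℝ) : ℂ)‖ₑ := by
        rw [integral_complex_ofReal, ← ofReal_norm, Complex.norm_real,
          Real.norm_of_nonneg (integral_nonneg hnn)]
    _ ≤ _ := by
        rw [integral_normSq_mul_gaussWeight hΦ hh hs]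
        refine (enorm_integral_le_lintegral_enorm _).trans ?_
        refine (lintegral_mono fun z => ?_).trans (lintegral_schur_gaussKernel_le hΦ hK hh.1 hs)
        rw [enorm_mul, enorm_mul, ← ofReal_norm ((gaussKernel s _ : ℝ) : ℂ),
          Complex.norm_real, Real.norm_of_nonneg (gaussKernel_nonneg hs _)]
        simp

/-- An `L²` bound for the Fourier transform of the push-forward of `h ρ` under `Φ`, when the
push-forward of `ρ` has density at most `K`. -/
theorem lintegral_sq_integral_planeChar_le [SFinite ρ] {K : ℝ≥0∞} (hΦ : Measurable Φ)
    (hK : ρ.map Φ ≤ K • volume) (hh : Integrable h ρ) :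
    ∫⁻ x, ‖∫ p, h p * planeChar x (Φ p) ∂ρ‖ₑ ^ 2 ≤ K * ∫⁻ p, ‖h p‖ₑ ^ 2 ∂ρ := by
  set F := fun x => ∫ p, h p * planeChar x (Φ p) ∂ρ with hF
  have hFc : Continuous F := continuous_integral_planeChar hΦ hh
  have hlim : ∀ x, Filter.Tendsto (fun n : ℕ => ‖F x‖ₑ ^ 2 *
      ENNReal.ofReal (gaussWeight (1 / ((n : ℝ) + 1)) x)) Filter.atTop (nhds (‖F x‖ₑ ^ 2)) := by
    intro x
    have hc : Continuous fun s => gaussWeight s x := by unfold gaussWeight; fun_prop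
    have h0 := (ENNReal.tendsto_ofReal ((hc.tendsto 0).comp
      tendsto_one_div_add_atTop_nhds_zero_nat))
    have : gaussWeight 0 x = 1 := by simp [gaussWeight]
    rw [this, ENNReal.ofReal_one] at h0
    simpa using ENNReal.Tendsto.const_mul (a := ‖F x‖ₑ ^ 2) h0 (Or.inl one_ne_zero)
  calc ∫⁻ x, ‖F x‖ₑ ^ 2
      = ∫⁻ x, Filter.liminf (fun n : ℕ => ‖F x‖ₑ ^ 2 *
          ENNReal.ofReal (gaussWeight (1 / ((n : ℝ) + 1)) x)) Filter.atTop := by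
        congr 1 with x
        exact (hlim x).liminf_eq.symm
    -- Fatou's lemma, as the weights tend to 1 and the weighted bound does not depend on `n`.
    _ ≤ Filter.liminf (fun n : ℕ => ∫⁻ x, ‖F x‖ₑ ^ 2 *
          ENNReal.ofReal (gaussWeight (1 / ((n : ℝ) + 1)) x)) Filter.atTop := by
        refine lintegral_liminf_le fun n => ?_
        exact (hFc.measurable.enorm.pow_const 2).mul
          (continuous_gaussWeight _).measurable.ennreal_ofReal
    _ ≤ _ := by
        refine Filter.liminf_le_of_le (by isBoundedDefault) fun b hb => ?_
        obtain ⟨n, hn⟩ := hb.exists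
        exact hn.trans (lintegral_sq_mul_gaussWeight_le hΦ hK hh (by positivity))

end Bessel

/-! ### Geometry of sums of two points of the parabola -/

/-- The map `(ξ, η) ↦ (ξ + η, ξ² + η²)`, the sum of the points of the parabola over `ξ`, `η`. -/
def parabolaSum (p : ℝ × ℝ) : ℝ × ℝ := (p.1 + p.2, p.1 ^ 2 + p.2 ^ 2)

/-- The derivative of `parabolaSum`. -/
noncomputable def fderivParabolaSum (p : ℝ × ℝ) : ℝ × ℝ →L[ℝ] ℝ × ℝ :=
  LinearMap.toContinuousLinearMap (Matrix.toLin (Module.Basis.finTwoProd ℝ)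
    (Module.Basis.finTwoProd ℝ) !![1, 1; 2 * p.1, 2 * p.2])

lemma hasFDerivAt_parabolaSum (p : ℝ × ℝ) :
    HasFDerivAt parabolaSum (fderivParabolaSum p) p := by
  unfold parabolaSum fderivParabolaSum
  rw [Matrix.toLin_finTwoProd_toContinuousLinearMap]
  have h1 : HasFDerivAt (fun p : ℝ × ℝ => p.1) (ContinuousLinearMap.fst ℝ ℝ ℝ) p := hasFDerivAt_fst
  have h2 : HasFDerivAt (fun p : ℝ × ℝ => p.2) (ContinuousLinearMap.snd ℝ ℝ ℝ) p := hasFDerivAt_snd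
  refine ((h1.add h2).prodMk ((h1.pow 2).add (h2.pow 2))).congr_fderiv ?_
  ext <;> simp

lemma det_fderivParabolaSum (p : ℝ × ℝ) : (fderivParabolaSum p).det = 2 * (p.2 - p.1) := by
  simp only [fderivParabolaSum, LinearMap.det_toContinuousLinearMap, LinearMap.det_toLin,
    Matrix.det_fin_two_of]
  ring

lemma measurable_parabolaSum : Measurable parabolaSum := by
  unfold parabolaSum
  fun_prop

/-- The sum and the sum of squares determine a pair up to order, and disjointness rules out the
swap. -/
lemma injOn_parabolaSum {A B : Set ℝ} (h : Disjoint A B) : Set.InjOn parabolaSum (A ×ˢ B) := by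
  rintro ⟨a, b⟩ ⟨ha, hb⟩ ⟨c, d⟩ ⟨hc, hd⟩ heq
  simp only [parabolaSum, Prod.mk.injEq] at heq ha hb hc hd
  obtain ⟨h1, h2⟩ := heq
  have hprod : (a - c) * (a - d) = 0 := by
    obtain rfl : b = c + d - a := by linarith
    nlinarith
  rcases mul_eq_zero.1 hprod with h3 | h3
  · exact Prod.ext (by simp only; linarith) (by simp only; linarith)
  · obtain rfl : a = d := by linarith
    exact (h.ne_of_mem ha hd rfl).elim

lemma map_parabolaSum_le {D : ℝ} (hD : 0 < D) {A B : Set ℝ} (hA : MeasurableSet A)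
    (hB : MeasurableSet B) (hAB : ∀ a ∈ A, ∀ b ∈ B, D ≤ |a - b|) :
    (volume.restrict (A ×ˢ B)).map parabolaSum ≤
      ENNReal.ofReal (2 * D)⁻¹ • (volume : Measure (ℝ × ℝ)) := by
  have hdisj : Disjoint A B := Set.disjoint_left.2 fun x hx hx' => by
    have := hAB x hx x hx'
    simp at this
    linarith
  refine Measure.le_iff.2 fun S hS => ?_
  rw [Measure.map_apply measurable_parabolaSum hS,
    Measure.restrict_apply (measurable_parabolaSum hS), Measure.smul_apply, smul_eq_mul]
  set T := parabolaSum ⁻¹' S ∩ A ×ˢ B with hT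
  have hTm : MeasurableSet T := (measurable_parabolaSum hS).inter (hA.prod hB)
  have hcov := lintegral_abs_det_fderiv_eq_addHaar_image volume hTm
    (fun p _ => (hasFDerivAt_parabolaSum p).hasFDerivWithinAt)
    ((injOn_parabolaSum hdisj).mono Set.inter_subset_right)
  -- Change of variables, with the Jacobian bounded below by `2D` on `T`.
  have hlow : ENNReal.ofReal (2 * D) * volume T ≤ volume (parabolaSum '' T) := by
    rw [← hcov, ← setLIntegral_const]
    refine setLIntegral_mono' hTm fun p hp => ENNReal.ofReal_le_ofReal ?_
    rw [det_fderivParabolaSum, abs_mul, abs_sub_comm, abs_two]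
    have := hAB p.1 hp.2.1 p.2 hp.2.2
    linarith
  have hup : volume (parabolaSum '' T) ≤ volume S :=
    measure_mono (Set.image_subset_iff.2 Set.inter_subset_left)
  rw [ENNReal.ofReal_inv_of_pos (by positivity), mul_comm, ← div_eq_mul_inv,
    ENNReal.le_div_iff_mul_le (Or.inl (by simpa using hD)) (Or.inl ENNReal.ofReal_ne_top), mul_comm]
  exact hlow.trans hup

/-! ### The bilinear estimate -/

lemma setDist_le {A B : Set ℝ} {a b : ℝ} (ha : a ∈ A) (hb : b ∈ B) : setDist A B ≤ |a - b| := by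
  refine csInf_le ⟨0, ?_⟩ ⟨a, ha, b, hb, Real.dist_eq a b⟩
  rintro _ ⟨x, -, y, -, rfl⟩
  exact dist_nonneg

lemma parabolaExt_mul_parabolaExt (A B : Set ℝ) (f : ℝ → ℂ) (x : ℝ × ℝ) :
    parabolaExt A f x * parabolaExt B f x =
      ∫ p in A ×ˢ B, f p.1 * f p.2 * planeChar x (parabolaSum p) := by
  rw [parabolaExt, parabolaExt, ← integral_prod_mul, Measure.prod_restrict, ← Measure.volume_eq_prod]
  congr 1 with p
  rw [mul_mul_mul_comm, ← Complex.exp_add, planeChar, parabolaSum]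
  congr 2
  push_cast
  ring

/-- The bilinear `L²` estimate for the extension operator of the parabola. -/
theorem lintegral_sq_parabolaExt_mul_le {D : ℝ} (hD : 0 < D) {A B : Set ℝ}
    (hA : MeasurableSet A) (hB : MeasurableSet B) (hAB : ∀ a ∈ A, ∀ b ∈ B, D ≤ |a - b|)
    {f : ℝ → ℂ} (hfA : IntegrableOn f A) (hfB : IntegrableOn f B) :
    ∫⁻ x, ‖parabolaExt A f x * parabolaExt B f x‖ₑ ^ 2 ≤
      ENNReal.ofReal (2 * D)⁻¹ * ((∫⁻ ξ in A, ‖f ξ‖ₑ ^ 2) * ∫⁻ η in B, ‖f η‖ₑ ^ 2) := by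
  have hprod : (volume : Measure (ℝ × ℝ)).restrict (A ×ˢ B) =
      (volume.restrict A).prod (volume.restrict B) := by
    rw [Measure.prod_restrict, Measure.volume_eq_prod]
  have hh : Integrable (fun p : ℝ × ℝ => f p.1 * f p.2) (volume.restrict (A ×ˢ B)) := by
    rw [hprod]
    exact hfA.mul_prod hfB
  simp_rw [parabolaExt_mul_parabolaExt]
  refine (lintegral_sq_integral_planeChar_le measurable_parabolaSum
    (map_parabolaSum_le hD hA hB hAB) hh).trans_eq ?_
  rw [hprod, ← lintegral_prod_mul (hfA.1.enorm.pow_const 2) (hfB.1.enorm.pow_const 2)]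
  simp_rw [enorm_mul, mul_pow]

lemma eLpNorm_norm_rpow_half_four {α : Type*} [MeasurableSpace α] {μ : Measure α} (F : α → ℂ) :
    eLpNorm (fun x => ‖F x‖ ^ (1 / 2 : ℝ)) 4 μ = (∫⁻ x, ‖F x‖ₑ ^ 2 ∂μ) ^ (1 / 4 : ℝ) := by
  rw [eLpNorm_eq_lintegral_rpow_enorm_toReal (by simp) (by simp)]
  simp only [ENNReal.toReal_ofNat]
  congr 2 with x
  rw [Real.enorm_rpow_of_nonneg (norm_nonneg _) (by norm_num), enorm_norm, ← ENNReal.rpow_mul,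
    ← ENNReal.rpow_natCast]
  norm_num

lemma lintegral_sq_enorm_eq {α : Type*} [MeasurableSpace α] {μ : Measure α} (f : α → ℂ) :
    ∫⁻ x, ‖f x‖ₑ ^ 2 ∂μ = eLpNorm f 2 μ ^ 2 := by
  have h := eLpNorm_nnreal_pow_eq_lintegral (f := f) (μ := μ) (p := 2) (by simp)
  simpa using h.symm

theorem mainTheorem2 (D : ℝ) (hD : 0 < D) :
    ∃ C : ℝ≥0, ∀ J₁ J₂ : Set ℝ,
      J₁.OrdConnected → J₂.OrdConnected → J₁.Nonempty → J₂.Nonempty →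
      J₁ ⊆ Set.Icc (-1) 1 → J₂ ⊆ Set.Icc (-1) 1 → D ≤ setDist J₁ J₂ →
      ∀ f : ℝ → ℂ, MemLp f 2 (volume.restrict (J₁ ∪ J₂)) →
        eLpNorm (fun x : ℝ × ℝ => ‖parabolaExt J₁ f x * parabolaExt J₂ f x‖ ^ (1 / 2 : ℝ)) 4 volume
          ≤ (C : ℝ≥0∞) *
            (eLpNorm f 2 (volume.restrict J₁) * eLpNorm f 2 (volume.restrict J₂)) ^ (1 / 2 : ℝ) := by
  -- The fourth root appears because the left side is `(∫ |F|²)^(1/4)`, where `F` is the product of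
  -- the extensions.
  refine ⟨(2 * D)⁻¹.toNNReal ^ (1 / 4 : ℝ), fun J₁ J₂ h₁ h₂ _ _ hs₁ hs₂ hdist f hf => ?_⟩
  -- On a bounded set `L²` embeds in `L¹`, which the Fubini arguments need.
  have hint : ∀ J : Set ℝ, J ⊆ J₁ ∪ J₂ → J ⊆ Set.Icc (-1) 1 → IntegrableOn f J := by
    intro J hJ hJ'
    have : IsFiniteMeasure (volume.restrict J) := isFiniteMeasure_restrict.2
      (measure_mono hJ' |>.trans_lt (by simp)).ne
    exact (hf.mono_measure (Measure.restrict_mono hJ le_rfl)).integrable (by norm_num)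
  have key := lintegral_sq_parabolaExt_mul_le hD h₁.measurableSet h₂.measurableSet
    (fun a ha b hb => hdist.trans (setDist_le ha hb))
    (hint J₁ Set.subset_union_left hs₁) (hint J₂ Set.subset_union_right hs₂)
  rw [lintegral_sq_enorm_eq f, lintegral_sq_enorm_eq f, ← mul_pow] at key
  rw [eLpNorm_norm_rpow_half_four]
  refine (ENNReal.rpow_le_rpow key (by norm_num)).trans_eq ?_
  rw [ENNReal.mul_rpow_of_nonneg _ _ (by norm_num), ← ENNReal.rpow_natCast, ← ENNReal.rpow_mul,
    ENNReal.coe_rpow_of_nonneg _ (by norm_num)]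
  norm_num
  rfl
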